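/- **Setting.** Let $(\mathcal S,\mathcal A,T,r,\gamma)$ be a Markov decision process with discount factor $\gamma\in(0,1)$, bounded measurable deterministic reward $r:\mathcal S\times\mathcal A\to\mathbb R$, and transition law $T(\cdot\mid s,a)$ that has a density with respect to a $\sigma$-finite reference measure on $\mathcal S$ (e.g. Lebesgue measure); the action space $\mathcal A$ is a separable metric space with metric $d$ (e.g. a subset of $\mathbb R^m$). Let $\rho_0$ be an initial state distribution with a density with respect to the same reference measure. Let $N\ge 1$, let $\pi^1,\dots,\pi^N$ be given (possibly deterministic) Markov policies, and let $w_1,\dots,w_N>0$ be weights. For each episode $e=1,\dots,N$ an infinite trajectory $(s_i^e,a_i^e)_{i\ge 0}$ is sampled with $s_0^e\sim\rho_0$, $a_i^e\sim\pi^e(\cdot\mid s_i^e)$, $s_{i+1}^e\sim T(\cdot\mid s_i^e,a_i^e)$, independently over the episodes. For a policy $\pi$ let $$Q^{\pi}(s,a)=\mathbb E\Big[\sum_{i\ge0}\gamma^i r(s_i,a_i)\,\Big|\,s_0=s,\ a_0=a,\ s_{i+1}\sim T(\cdot\mid s_i,a_i),\ a_{i+1}\sim\pi(\cdot\mid s_{i+1})\Big],$$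 $$(\mathcal B^{\pi}Q)(s,a)=r(s,a)+\gamma\,\mathbb E_{s'\sim T(\cdot\mid s,a),\,a'\sim\pi(\cdot\mid s')}Q(s',a').$$ Let $\rho^{\pi^e}(s)=(1-\gamma)\sum_{i\ge0}\gamma^i\rho_i^e(s)$, where $\rho_i^e$ is the density of $s_i^e$, be the density of the normalized state occupancy measure of $(\rho_0,\pi^e,T)$, and define the weighted behaviour policy $$\pi^D_{0,w}(\cdot\mid s)=\frac{\sum_{e}w_e\,\rho^{\pi^e}(s)\,\pi^e(\cdot\mid s)}{\sum_{e}w_e\,\rho^{\pi^e}(s)} .$$ For a function $f$ on $\mathcal S\times\mathcal A$ (or on $\mathcal S$) put $$\tilde E_{0,w}^{\infty}f=\frac1{\sum_e w_e}\sum_{e=1}^N\sum_{i=0}^\infty(1-\gamma)\gamma^i w_e f(s_i^e,a_i^e).$$ Let $\hat Q:\mathcal S\times\mathcal A\to\mathbb R$ be a given measurable function (the estimated Q function), and put $$\epsilon_{\hat Q,w}^{0,\infty}=\tilde E_{0,w}^{\infty}\big|\hat Q-\mathcal B^{\pi^N}\hat Q\big|,\qquad W_{1,w}^{0,\infty}=\tilde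 E_{0,w}^{\infty}\big[s\mapsto W_1\big(\pi^N(\cdot\mid s),\pi^D_{0,w}(\cdot\mid s)\big)\big],$$ where $W_1$ is the 1-Wasserstein distance for $d$. **Theorem.** Assume that, for constants $L_{\mathcal A}\ge 0$ and $r^{\max}$, (1) for each $s\in\mathcal S$, $\hat Q(s,a)$ and $Q^{\pi^N}(s,a)$ are $L_{\mathcal A}$-Lipschitz in $a$; (2) $\hat Q$ and $Q^{\pi^N}$ take values in $[0,r^{\max}/(1-\gamma)]$; (3) $\mathcal A$ is bounded, with diameter $\mathrm{diam}_{\mathcal A}<\infty$. Then for every $\delta\in(0,1)$, with probability greater than $1-\delta$ over the sampled trajectories, $$\begin{aligned} \mathbb E_{s_0\sim\rho_0,\,a_0\sim\pi^D_{0,w}(\cdot\mid s_0)}\big|\hat Q(s_0,a_0)-Q^{\pi^N}(s_0,a_0)\big| \le{}&\frac{r^{\max}}{1-\gamma}\sqrt{\frac{\sum_e w_e^2}{2(\sum_e w_e)^2}\log\frac2\delta}\\ &+\Big(\frac{r^{\max}}{(1-\gamma)^2}+\frac{2L_{\mathcal A}\,\mathrm{diam}_{\mathcal A}}{1-\gamma}\Big)\sqrt{\frac{2\sum_e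 w_e^2}{(\sum_e w_e)^2}\log\frac2\delta}\\ &+\frac1{1-\gamma}\Big(\epsilon_{\hat Q,w}^{0,\infty}+2L_{\mathcal A}W_{1,w}^{0,\infty}\Big). \end{aligned}$$ -/

import Mathlib

open MeasureTheory ProbabilityTheory
open scoped ENNReal NNReal

noncomputable section

namespace OffPolicy

/-- The 1-Wasserstein distance: the infimum of `∫ d(x, y) dc(x, y)` over all couplings `c`
of `μ` and `ν`. -/
def wasserstein1 {A : Type*} [MetricSpace A] [MeasurableSpace A] (μ ν : Measure A) : ℝ :=
  (⨅ (c : Measure (A × A)) (_ : c.map Prod.fst = μ) (_ : c.map Prod.snd = ν),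
    ∫⁻ p, edist p.1 p.2 ∂c).toReal

section MDP

variable {S A : Type*} [MeasurableSpace S] [MeasurableSpace A]

/-- One step of the state-action chain: `s' ∼ T(· | s, a)`, then `a' ∼ π(· | s')`. -/
def stepKernel (T : Kernel (S × A) S) (π : Kernel S A) : Kernel (S × A) (S × A) :=
  T.compProd (Kernel.prodMkLeft (S × A) π)

instance (T : Kernel (S × A) S) (π : Kernel S A) [IsMarkovKernel T] [IsMarkovKernel π] :
    IsMarkovKernel (stepKernel T π) := by
  unfold stepKernel; infer_instance

/-- The step at time `n` as a function of the history up to time `n`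
(it depends on the last state-action pair only). -/
def historyKernel (T : Kernel (S × A) S) (π : Kernel S A) (n : ℕ) :
    Kernel (Finset.Iic n → S × A) (S × A) :=
  (stepKernel T π).comap (fun h => h ⟨n, Finset.mem_Iic.2 le_rfl⟩) (measurable_pi_apply _)

instance (T : Kernel (S × A) S) (π : Kernel S A) [IsMarkovKernel T] [IsMarkovKernel π] (n : ℕ) :
    IsMarkovKernel (historyKernel T π n) := by
  unfold historyKernel; infer_instance

/-- The law of the infinite trajectory `(s_i, a_i)_{i ≥ 0}` under `(π, T)`, given
`(s_0, a_0)`. -/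
def pathKernel (T : Kernel (S × A) S) (π : Kernel S A) [IsMarkovKernel T] [IsMarkovKernel π] :
    Kernel (S × A) (ℕ → S × A) :=
  (Kernel.traj (X := fun _ => S × A) (historyKernel T π) 0).comap (fun x _ => x)
    (measurable_pi_lambda _ fun _ => measurable_id)

/-- The law of the infinite trajectory with `s_0 ∼ ρ₀`, `a_i ∼ π(· | s_i)`,
`s_{i+1} ∼ T(· | s_i, a_i)`. -/
def pathLaw (ρ₀ : Measure S) (T : Kernel (S × A) S) (π : Kernel S A)
    [IsMarkovKernel T] [IsMarkovKernel π] : Measure (ℕ → S × A) :=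
  (ρ₀.compProd π).bind (pathKernel T π)

/-- The state distribution at trajectory step `i`. -/
def stateLaw (ρ₀ : Measure S) (T : Kernel (S × A) S) (π : Kernel S A)
    [IsMarkovKernel T] [IsMarkovKernel π] (i : ℕ) : Measure S :=
  (pathLaw ρ₀ T π).map (fun x => (x i).1)

/-- The normalized discounted state occupancy measure
`(1 - γ) ∑ i, γ ^ i * (state distribution at step i)`. -/
def occupancy (γ : ℝ) (ρ₀ : Measure S) (T : Kernel (S × A) S) (π : Kernel S A)
    [IsMarkovKernel T] [IsMarkovKernel π] : Measure S :=
  Measure.sum fun i : ℕ => ENNReal.ofReal ((1 - γ) * γ ^ i) • stateLaw ρ₀ T π i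

/-- The density of the occupancy measure with respect to the reference measure `ν`. -/
def occupancyDensity (ν : Measure S) (γ : ℝ) (ρ₀ : Measure S) (T : Kernel (S × A) S)
    (π : Kernel S A) [IsMarkovKernel T] [IsMarkovKernel π] : S → ℝ≥0∞ :=
  (occupancy γ ρ₀ T π).rnDeriv ν

/-- The weighted behaviour policy
`π^D(· | s) = (∑ e, w_e ρ_e(s) π_e(· | s)) / (∑ e, w_e ρ_e(s))`, where `ρ_e` is the density of
the occupancy measure of `(ρ₀, π_e, T)`. -/
def behaviorPolicy {N : ℕ} (ν : Measure S) (γ : ℝ) (ρ₀ : Measure S) (T : Kernel (S × A) S)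
    (π : Fin N → Kernel S A) [IsMarkovKernel T] [∀ e, IsMarkovKernel (π e)] (w : Fin N → ℝ)
    (s : S) : Measure A :=
  ∑ e, (ENNReal.ofReal (w e) * occupancyDensity ν γ ρ₀ T (π e) s /
    ∑ e', ENNReal.ofReal (w e') * occupancyDensity ν γ ρ₀ T (π e') s) • π e s

/-- The Q function: the expected discounted reward along the trajectory started at `(s, a)`. -/
def qFunction (γ : ℝ) (r : S → A → ℝ) (T : Kernel (S × A) S) (π : Kernel S A)
    [IsMarkovKernel T] [IsMarkovKernel π] (s : S) (a : A) : ℝ :=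
  ∫ x, ∑' i : ℕ, γ ^ i * r (x i).1 (x i).2 ∂(pathKernel T π (s, a))

/-- The Bellman operator `(B^π Q)(s, a) = r(s, a) + γ E[Q(s', a')]`. -/
def bellman (γ : ℝ) (r : S → A → ℝ) (T : Kernel (S × A) S) (π : Kernel S A)
    (Q : S → A → ℝ) (s : S) (a : A) : ℝ :=
  r s a + γ * ∫ s', ∫ a', Q s' a' ∂(π s') ∂(T (s, a))

/-- The weighted averaging-discounted operator
`(∑ e, w_e)⁻¹ ∑ e, ∑ i, (1 - γ) γ ^ i w_e f(s_i^e, a_i^e)` over the trajectories `x e`. -/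
def weightedAverage {N : ℕ} (γ : ℝ) (w : Fin N → ℝ) (x : Fin N → ℕ → S × A)
    (f : S → A → ℝ) : ℝ :=
  (1 / ∑ e, w e) * ∑ e, ∑' i : ℕ, (1 - γ) * γ ^ i * w e * f (x e i).1 (x e i).2

end MDP

end OffPolicy

end

/-! Write f = |Q̂ - Q^{π^N}|, ε = |Q̂ - B^{π^N} Q̂| and o_e for the occupancy measure of π^e. Since
Q^{π^N} is fixed by its Bellman operator, f ≤ ε + γ T π^N f pointwise.

Deterministic part (`lintegral_behaviorPolicy_le`). Replacing π^N by the behaviour policy π^D inside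
this inequality costs at most a gap k(s). Integrate against o_e ⊗ π^e and use the flow equation o_e
= (1-γ) ρ₀ + γ T(o_e ⊗ π^e) (`occupancy_eq`) to trade the next-state law for o_e minus (1-γ) ρ₀.
After summing with the weights w_e, the o_e-means of f under π^e and under π^D agree, because π^D is
the conditional action law of the mixture (`sum_lintegral_behaviorPolicy`). They cancel, leaving
(1-γ) (∑ w_e) E_{ρ₀, π^D} f ≤ ∑ w_e ∫ (ε + k) d(o_e ⊗ π^e).

Random part. Each integral on the right is the mean of the discounted sum of ε + k along episode e.
These sums are independent and lie in a bounded interval, so a single one-sided Hoeffding bound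
(`exists_measurableSet_sum_integral_le`) replaces means by samples. As f is 2L-Lipschitz in the
action, the easy half of Kantorovich duality gives k ≤ 2L W₁ (`policyGap_le`); this is applied only
along the sampled paths, so measurability of s ↦ W₁ is never needed. -/

namespace OffPolicy

/-! ### One-step marginals of the trajectory law -/

section Marginals

variable {S A : Type*} [MeasurableSpace S] [MeasurableSpace A]
  (T : Kernel (S × A) S) (π : Kernel S A) [IsMarkovKernel T] [IsMarkovKernel π]

instance : IsMarkovKernel (pathKernel T π) := by
  unfold pathKernel; infer_instance

instance (ρ₀ : Measure S) [IsProbabilityMeasure ρ₀] : IsProbabilityMeasure (pathLaw ρ₀ T π) := by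
  unfold pathLaw; infer_instance

/-- `historyKernel` reads only the last coordinate of the history, so extending the trajectory by
one step acts on the marginal at step `i` alone. -/
lemma traj_map_succ (i : ℕ) :
    (Kernel.traj (X := fun _ => S × A) (historyKernel T π) 0).map (fun x => x (i + 1)) =
      stepKernel T π ∘ₖ
        (Kernel.traj (X := fun _ => S × A) (historyKernel T π) 0).map (fun x => x i) := by
  have h : (fun x : ℕ → S × A => x i) =
      (fun h : Finset.Iic i → S × A => h ⟨i, Finset.mem_Iic.2 le_rfl⟩) ∘ Preorder.frestrictLe i :=
    rfl
  rw [h, Kernel.map_comp_right _ (Preorder.measurable_frestrictLe i) (by fun_prop),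
    Kernel.traj_map_frestrictLe,
    ← Kernel.traj_comp_partialTraj (X := fun _ => S × A) (κ := historyKernel T π) (Nat.zero_le i),
    Kernel.map_comp, Kernel.map_traj_succ_self, Kernel.comp_map _ _ (by fun_prop)]
  rfl

lemma pathKernel_map_zero :
    (pathKernel T π).map (fun x => x 0) = (Kernel.id : Kernel (S × A) (S × A)) := by
  have h : (fun x : ℕ → S × A => x 0) =
      (fun h : Finset.Iic 0 → S × A => h ⟨0, Finset.mem_Iic.2 le_rfl⟩) ∘ Preorder.frestrictLe 0 :=
    rfl
  have h0 : (Kernel.traj (X := fun _ => S × A) (historyKernel T π) 0).map (fun x => x 0) =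
      (Kernel.id : Kernel (Finset.Iic 0 → S × A) _).map
        (fun h : Finset.Iic 0 → S × A => h ⟨0, Finset.mem_Iic.2 le_rfl⟩) := by
    rw [h, Kernel.map_comp_right _ (Preorder.measurable_frestrictLe 0) (by fun_prop),
      Kernel.traj_map_frestrictLe,
      Kernel.partialTraj_self]
  ext1 z
  have h1 := DFunLike.congr_fun h0 (fun _ => z)
  rw [Kernel.map_apply _ (by fun_prop)] at h1 ⊢
  rw [pathKernel, Kernel.comap_apply, h1, Kernel.map_apply _ (by fun_prop), Kernel.id_apply,
    Kernel.id_apply, Measure.map_dirac' (measurable_pi_apply _)]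

lemma pathKernel_map_succ (i : ℕ) :
    (pathKernel T π).map (fun x => x (i + 1)) =
      stepKernel T π ∘ₖ (pathKernel T π).map (fun x => x i) := by
  ext1 z
  have h := DFunLike.congr_fun (traj_map_succ T π i) (fun _ => z)
  rw [Kernel.map_apply _ (by fun_prop), Kernel.comp_apply,
    Kernel.map_apply _ (by fun_prop)] at h ⊢
  exact h

/-- Powers of a kernel commute with it, so the extra step may be taken first instead of last. This
first-step form yields the Bellman equation. -/
lemma pathKernel_map_succ' (i : ℕ) :
    (pathKernel T π).map (fun x => x (i + 1)) =
      (pathKernel T π).map (fun x => x i) ∘ₖ stepKernel T π := by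
  induction i with
  | zero => rw [pathKernel_map_succ, pathKernel_map_zero, Kernel.comp_id, Kernel.id_comp]
  | succ i ih => rw [pathKernel_map_succ, ih, ← Kernel.comp_assoc, ← pathKernel_map_succ, ih]

lemma pathLaw_map (ρ₀ : Measure S) (i : ℕ) :
    (pathLaw ρ₀ T π).map (fun x => x i) =
      ((pathKernel T π).map (fun x => x i)) ∘ₘ (ρ₀.compProd π) := by
  rw [pathLaw, Measure.map_comp _ _ (by fun_prop)]

/-- The new action depends on the past only through the new state. Hence every state-action marginal
disintegrates along `π`. -/
lemma comp_stepKernel (μ : Measure (S × A)) [SFinite μ] :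
    stepKernel T π ∘ₘ μ = (T ∘ₘ μ).compProd π := by
  ext s hs
  rw [Measure.bind_apply hs (by fun_prop), Measure.compProd_apply hs,
    Measure.lintegral_bind (by fun_prop) (Kernel.measurable_kernel_prodMk_left hs).aemeasurable]
  refine lintegral_congr fun z => ?_
  rw [stepKernel, Kernel.compProd_apply hs]
  rfl

lemma stateLaw_eq_map_fst (ρ₀ : Measure S) (i : ℕ) :
    stateLaw ρ₀ T π i = ((pathLaw ρ₀ T π).map (fun x => x i)).fst := by
  rw [stateLaw, Measure.fst, Measure.map_map (by fun_prop) (by fun_prop)]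
  rfl

lemma pathLaw_map_zero (ρ₀ : Measure S) :
    (pathLaw ρ₀ T π).map (fun x => x 0) = ρ₀.compProd π := by
  rw [pathLaw_map, pathKernel_map_zero, Measure.id_comp]

lemma pathLaw_map_succ (ρ₀ : Measure S) (i : ℕ) :
    (pathLaw ρ₀ T π).map (fun x => x (i + 1)) =
      stepKernel T π ∘ₘ (pathLaw ρ₀ T π).map (fun x => x i) := by
  rw [pathLaw_map, pathLaw_map, pathKernel_map_succ, Measure.comp_assoc]

variable (ρ₀ : Measure S) [IsProbabilityMeasure ρ₀]

lemma stateLaw_zero : stateLaw ρ₀ T π 0 = ρ₀ := by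
  rw [stateLaw_eq_map_fst, pathLaw_map_zero, Measure.fst_compProd]

lemma stateLaw_succ (i : ℕ) :
    stateLaw ρ₀ T π (i + 1) = T ∘ₘ (pathLaw ρ₀ T π).map (fun x => x i) := by
  rw [stateLaw_eq_map_fst, pathLaw_map_succ, comp_stepKernel, Measure.fst_compProd]

lemma pathLaw_map_eq_compProd (i : ℕ) :
    (pathLaw ρ₀ T π).map (fun x => x i) = (stateLaw ρ₀ T π i).compProd π := by
  cases i with
  | zero => rw [pathLaw_map_zero, stateLaw_zero]
  | succ i => rw [pathLaw_map_succ, comp_stepKernel, stateLaw_succ]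

instance (i : ℕ) : IsProbabilityMeasure (stateLaw ρ₀ T π i) := by
  unfold stateLaw
  exact Measure.isProbabilityMeasure_map (measurable_pi_apply i).fst.aemeasurable

lemma stateLaw_absolutelyContinuous {ν : Measure S} (hρ₀ : ρ₀ ≪ ν) (hT : ∀ x, T x ≪ ν) (i : ℕ) :
    stateLaw ρ₀ T π i ≪ ν := by
  cases i with
  | zero => rwa [stateLaw_zero]
  | succ i =>
    rw [stateLaw_succ]
    refine Measure.AbsolutelyContinuous.mk fun s hs h0 => ?_
    rw [Measure.bind_apply hs (by fun_prop)]
    simp [fun z => hT z h0]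

end Marginals

/-! ### Discounted occupancy measures -/

section Occupancy

variable {S A : Type*} [MeasurableSpace S] [MeasurableSpace A]
  (γ : ℝ) (ρ₀ : Measure S) (T : Kernel (S × A) S) (π : Kernel S A)
  [IsMarkovKernel T] [IsMarkovKernel π] [IsProbabilityMeasure ρ₀]

lemma tsum_ofReal_discount (hγ0 : 0 ≤ γ) (hγ1 : γ < 1) :
    ∑' i : ℕ, ENNReal.ofReal ((1 - γ) * γ ^ i) = 1 := by
  rw [← ENNReal.ofReal_tsum_of_nonneg (fun i => by have := sub_nonneg.2 hγ1.le; positivity)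
    ((summable_geometric_of_lt_one hγ0 hγ1).mul_left _), tsum_mul_left,
    tsum_geometric_of_lt_one hγ0 hγ1, mul_inv_cancel₀ (by linarith), ENNReal.ofReal_one]

lemma occupancy_isProbabilityMeasure (hγ0 : 0 ≤ γ) (hγ1 : γ < 1) :
    IsProbabilityMeasure (occupancy γ ρ₀ T π) :=
  ⟨by simp [occupancy, tsum_ofReal_discount γ hγ0 hγ1]⟩

lemma occupancy_absolutelyContinuous {ν : Measure S} (hρ₀ : ρ₀ ≪ ν) (hT : ∀ x, T x ≪ ν) :
    occupancy γ ρ₀ T π ≪ ν :=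
  Measure.absolutelyContinuous_sum_left fun i =>
    (Measure.smul_absolutelyContinuous).trans (stateLaw_absolutelyContinuous T π ρ₀ hρ₀ hT i)

omit [IsProbabilityMeasure ρ₀] in
lemma lintegral_discounted_sum_eq_tsum {f : S × A → ℝ≥0∞} (hf : Measurable f) :
    ∫⁻ x, ∑' i : ℕ, ENNReal.ofReal ((1 - γ) * γ ^ i) * f (x i) ∂(pathLaw ρ₀ T π) =
      ∑' i : ℕ, ENNReal.ofReal ((1 - γ) * γ ^ i) *
        ∫⁻ z, f z ∂((pathLaw ρ₀ T π).map (fun x => x i)) := by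
  have h (i : ℕ) : Measurable fun x : ℕ → S × A => f (x i) := hf.comp (measurable_pi_apply i)
  rw [lintegral_tsum fun i => ((h i).const_mul _).aemeasurable]
  refine tsum_congr fun i => ?_
  rw [lintegral_const_mul _ (h i), lintegral_map hf (by fun_prop)]

/-- Expected discounted sums along a trajectory are integrals against the occupancy measure. -/
lemma lintegral_discounted_sum {f : S × A → ℝ≥0∞} (hf : Measurable f) :
    ∫⁻ x, ∑' i : ℕ, ENNReal.ofReal ((1 - γ) * γ ^ i) * f (x i) ∂(pathLaw ρ₀ T π) =
      ∫⁻ s, ∫⁻ a, f (s, a) ∂(π s) ∂(occupancy γ ρ₀ T π) := by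
  rw [lintegral_discounted_sum_eq_tsum _ _ _ _ hf, occupancy, lintegral_sum_measure]
  refine tsum_congr fun i => ?_
  rw [lintegral_smul_measure, ← Measure.lintegral_compProd hf, ← pathLaw_map_eq_compProd,
    smul_eq_mul]

/-- The flow equation of the occupancy measure. -/
lemma occupancy_eq (hγ0 : 0 ≤ γ) (hγ1 : γ < 1) :
    occupancy γ ρ₀ T π = ENNReal.ofReal (1 - γ) • ρ₀ +
      ENNReal.ofReal γ • (T ∘ₘ ((occupancy γ ρ₀ T π).compProd π)) := by
  have := occupancy_isProbabilityMeasure γ ρ₀ T π hγ0 hγ1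
  ext s hs
  rw [Measure.add_apply, Measure.smul_apply, Measure.smul_apply,
    Measure.bind_apply hs (by fun_prop),
    Measure.lintegral_compProd (T.measurable_coe hs), ← lintegral_discounted_sum γ ρ₀ T π
      (T.measurable_coe hs), lintegral_discounted_sum_eq_tsum _ _ _ _ (T.measurable_coe hs),
    occupancy, Measure.sum_apply _ hs, tsum_eq_zero_add' ENNReal.summable, smul_eq_mul,
    smul_eq_mul, ← ENNReal.tsum_mul_left]
  -- The occupancy series has been split at step 0, whose term is `ρ₀`; in the remaining terms the
  -- index shift releases one factor `γ`.
  congr 1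
  · simp [stateLaw_zero]
  · refine tsum_congr fun i => ?_
    rw [Measure.smul_apply, stateLaw_succ, Measure.bind_apply hs (by fun_prop), smul_eq_mul,
      ← mul_assoc, ← ENNReal.ofReal_mul hγ0]
    congr 2
    ring

end Occupancy

lemma integrable_of_abs_le {α : Type*} [MeasurableSpace α] (μ : Measure α) [IsFiniteMeasure μ]
    {f : α → ℝ} {C : ℝ} (hf : Measurable f) (hC : ∀ x, |f x| ≤ C) : Integrable f μ :=
  Integrable.of_bound hf.aestronglyMeasurable C
    (ae_of_all _ fun x => (Real.norm_eq_abs _).trans_le (hC x))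

lemma abs_integral_le_of_abs_le {α : Type*} [MeasurableSpace α] (μ : Measure α)
    [IsProbabilityMeasure μ] {f : α → ℝ} {C : ℝ} (hC : ∀ x, |f x| ≤ C) : |∫ x, f x ∂μ| ≤ C := by
  simpa using norm_integral_le_of_norm_le_const (μ := μ)
    (ae_of_all _ fun x => (Real.norm_eq_abs (f x)).trans_le (hC x))

/-! ### Discounted series of bounded functions -/

section Discounted

variable {γ : ℝ} (hγ0 : 0 ≤ γ) (hγ1 : γ < 1)
include hγ0 hγ1

lemma summable_discounted {u : ℕ → ℝ} {C : ℝ} (hu : ∀ i, |u i| ≤ C) :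
    Summable fun i => γ ^ i * u i := by
  refine Summable.of_norm_bounded ((summable_geometric_of_lt_one hγ0 hγ1).mul_right C) fun i => ?_
  rw [norm_mul, norm_pow, Real.norm_of_nonneg hγ0]
  exact mul_le_mul_of_nonneg_left (hu i) (by positivity)

lemma integral_discounted_tsum {α : Type*} [MeasurableSpace α] (μ : Measure α)
    [IsProbabilityMeasure μ] {f : ℕ → α → ℝ} {C : ℝ} (hf : ∀ i, Measurable (f i))
    (hC : ∀ i x, |f i x| ≤ C) :
    ∫ x, ∑' i, γ ^ i * f i x ∂μ = ∑' i, γ ^ i * ∫ x, f i x ∂μ := by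
  rw [← integral_tsum_of_summable_integral_norm]
  · simp_rw [integral_const_mul]
  · exact fun i => (integrable_of_abs_le μ (hf i) (hC i)).const_mul _
  · simp_rw [norm_mul, integral_const_mul, norm_pow, Real.norm_of_nonneg hγ0]
    exact summable_discounted hγ0 hγ1 fun i =>
      abs_integral_le_of_abs_le μ (C := C) fun x => by rw [Real.norm_eq_abs, abs_abs]; exact hC i x

end Discounted

lemma abs_sub_le_of_mem_Icc {S A : Type*} {Q Q' : S → A → ℝ} {B : ℝ}
    (hB : ∀ s a, Q s a ∈ Set.Icc 0 B) (hB' : ∀ s a, Q' s a ∈ Set.Icc 0 B) (s : S) (a : A) :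
    |Q s a - Q' s a| ≤ B :=
  abs_sub_le_iff.2 ⟨by linarith [(hB s a).2, (hB' s a).1], by linarith [(hB s a).1, (hB' s a).2]⟩

/-! ### Bellman equation and Bellman error -/

section QFunction

variable {S A : Type*} [MeasurableSpace S] [MeasurableSpace A]
  {γ : ℝ} (hγ0 : 0 ≤ γ) (hγ1 : γ < 1) {r : S → A → ℝ} (hr : Measurable (Function.uncurry r))
  {C : ℝ} (hC : ∀ s a, |r s a| ≤ C)
  (T : Kernel (S × A) S) (π : Kernel S A) [IsMarkovKernel T] [IsMarkovKernel π]
include hγ0 hγ1 hr hC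

instance isMarkovKernel_pathKernel_map (T : Kernel (S × A) S) (π : Kernel S A)
    [IsMarkovKernel T] [IsMarkovKernel π] (i : ℕ) :
    IsMarkovKernel ((pathKernel T π).map (fun x => x i)) :=
  Kernel.IsMarkovKernel.map _ (by fun_prop)

lemma qFunction_eq_tsum (z : S × A) :
    qFunction γ r T π z.1 z.2 =
      ∑' i : ℕ, γ ^ i * ∫ z', r z'.1 z'.2 ∂((pathKernel T π).map (fun x => x i) z) := by
  rw [qFunction, integral_discounted_tsum hγ0 hγ1 _ (C := C)
    (f := fun i (x : ℕ → S × A) => r (x i).1 (x i).2) (fun i => hr.comp (measurable_pi_apply i))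
    (fun i x => hC _ _)]
  refine tsum_congr fun i => ?_
  rw [Kernel.map_apply _ (by fun_prop), integral_map (measurable_pi_apply i).aemeasurable]
  exact hr.aestronglyMeasurable

lemma measurable_qFunction : Measurable (Function.uncurry (qFunction γ r T π)) := by
  have h (i : ℕ) : Measurable fun z : S × A =>
      γ ^ i * ∫ z', r z'.1 z'.2 ∂((pathKernel T π).map (fun x => x i) z) :=
    (StronglyMeasurable.integral_kernel (κ := (pathKernel T π).map (fun x => x i))
      hr.stronglyMeasurable).measurable.const_mul _
  refine measurable_of_tendsto_metrizable (fun n => Finset.measurable_sum (Finset.range n)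
    fun i _ => h i) (tendsto_pi_nhds.2 fun z => ?_)
  have := (summable_discounted hγ0 hγ1 (u := fun i =>
    ∫ z', r z'.1 z'.2 ∂((pathKernel T π).map (fun x => x i) z))
    fun i => abs_integral_le_of_abs_le _ fun z' => hC _ _).hasSum.tendsto_sum_nat
  rw [← qFunction_eq_tsum hγ0 hγ1 hr hC] at this
  simpa [Function.uncurry_def] using this

/-- The Bellman equation, with the one-step expectation written as a single integral. -/
lemma qFunction_eq (z : S × A) :
    qFunction γ r T π z.1 z.2 =
      r z.1 z.2 + γ * ∫ z', qFunction γ r T π z'.1 z'.2 ∂(stepKernel T π z) := by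
  have hb (i : ℕ) (z : S × A) :
      |∫ z', r z'.1 z'.2 ∂((pathKernel T π).map (fun x => x i) z)| ≤ C :=
    abs_integral_le_of_abs_le _ fun z' => hC _ _
  have hm (i : ℕ) : Measurable fun z : S × A =>
      ∫ z', r z'.1 z'.2 ∂((pathKernel T π).map (fun x => x i) z) :=
    (StronglyMeasurable.integral_kernel (κ := (pathKernel T π).map (fun x => x i))
      hr.stronglyMeasurable).measurable
  simp_rw [qFunction_eq_tsum hγ0 hγ1 hr hC]
  rw [(summable_discounted hγ0 hγ1 fun i => hb i z).tsum_eq_zero_add,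
    integral_discounted_tsum hγ0 hγ1 _ hm hb,
    ← tsum_mul_left, pathKernel_map_zero, Kernel.id_apply,
    integral_dirac' (fun z : S × A => r z.1 z.2) _ hr.stronglyMeasurable, pow_zero, one_mul]
  congr 1
  refine tsum_congr fun i => ?_
  rw [pathKernel_map_succ', Kernel.integral_comp, pow_succ', mul_assoc]
  exact integrable_of_abs_le _ hr fun z => hC _ _

omit hγ0 hγ1 hr hC in
lemma bellman_eq {Q : S → A → ℝ} (hQ : Measurable (Function.uncurry Q)) {B : ℝ}
    (hB : ∀ s a, |Q s a| ≤ B) (z : S × A) :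
    bellman γ r T π Q z.1 z.2 = r z.1 z.2 + γ * ∫ z', Q z'.1 z'.2 ∂(stepKernel T π z) := by
  rw [bellman, stepKernel, integral_compProd]
  · rfl
  · exact integrable_of_abs_le _ hQ fun z => hB _ _

omit hγ0 hγ1 hC in
lemma measurable_bellman {Q : S → A → ℝ} (hQ : Measurable (Function.uncurry Q)) {B : ℝ}
    (hB : ∀ s a, |Q s a| ≤ B) : Measurable (Function.uncurry (bellman γ r T π Q)) := by
  have : Function.uncurry (bellman γ r T π Q) =
      fun z => r z.1 z.2 + γ * ∫ z', Q z'.1 z'.2 ∂(stepKernel T π z) :=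
    funext fun z => bellman_eq T π hQ hB z
  rw [this]
  exact hr.add ((StronglyMeasurable.integral_kernel
    (κ := stepKernel T π) hQ.stronglyMeasurable).measurable.const_mul _)

variable {Q : S → A → ℝ} (hQ : Measurable (Function.uncurry Q)) {B : ℝ}
  (hB : ∀ s a, Q s a ∈ Set.Icc 0 B) (hB' : ∀ s a, qFunction γ r T π s a ∈ Set.Icc 0 B)
include hQ hB hB'

/-- By the Bellman equation both terms are the same reward plus a discounted one-step mean; the
rewards cancel. -/
lemma abs_bellman_sub_qFunction_le (z : S × A) :
    |bellman γ r T π Q z.1 z.2 - qFunction γ r T π z.1 z.2| ≤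
      γ * ∫ z', |Q z'.1 z'.2 - qFunction γ r T π z'.1 z'.2| ∂(stepKernel T π z) := by
  have h1 (s : S) (a : A) : |Q s a| ≤ B :=
    abs_le.2 ⟨by linarith [(hB s a).1, (hB s a).2], (hB s a).2⟩
  have h2 (s : S) (a : A) : |qFunction γ r T π s a| ≤ B :=
    abs_le.2 ⟨by linarith [(hB' s a).1, (hB' s a).2], (hB' s a).2⟩
  have i1 : Integrable (fun z' : S × A => Q z'.1 z'.2) (stepKernel T π z) :=
    integrable_of_abs_le _ hQ fun z => h1 _ _
  have i2 : Integrable (fun z' : S × A => qFunction γ r T π z'.1 z'.2) (stepKernel T π z) :=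
    integrable_of_abs_le _ (measurable_qFunction hγ0 hγ1 hr hC T π) fun z => h2 _ _
  rw [bellman_eq T π hQ h1, qFunction_eq hγ0 hγ1 hr hC T π z, add_sub_add_left_eq_sub, ← mul_sub,
    ← integral_sub i1 i2, abs_mul, abs_of_nonneg hγ0]
  exact mul_le_mul_of_nonneg_left abs_integral_le_integral_abs hγ0

/-- Passing through the Q function costs `B` plus at most `γ * B`, so the bound on the reward does
not enter the constant. -/
lemma abs_sub_bellman_le (s : S) (a : A) : |Q s a - bellman γ r T π Q s a| ≤ 2 * B := by
  have hd := abs_sub_le_of_mem_Icc hB hB'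
  have h := abs_bellman_sub_qFunction_le hγ0 hγ1 hr hC T π hQ hB hB' (s, a)
  have hB0 : 0 ≤ B := (hB s a).1.trans (hB s a).2
  have h2 : ∫ z', |Q z'.1 z'.2 - qFunction γ r T π z'.1 z'.2| ∂(stepKernel T π (s, a)) ≤ B :=
    (le_abs_self _).trans (abs_integral_le_of_abs_le _ fun z => by rw [abs_abs]; exact hd _ _)
  have h3 : |bellman γ r T π Q s a - qFunction γ r T π s a| ≤ B :=
    h.trans ((mul_le_mul_of_nonneg_left h2 hγ0).trans (by nlinarith))
  rw [abs_sub_comm] at h3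
  linarith [abs_sub_le (Q s a) (qFunction γ r T π s a) (bellman γ r T π Q s a), hd s a]

lemma ofReal_abs_sub_qFunction_le (z : S × A) :
    ENNReal.ofReal |Q z.1 z.2 - qFunction γ r T π z.1 z.2| ≤
      ENNReal.ofReal |Q z.1 z.2 - bellman γ r T π Q z.1 z.2| +
      ENNReal.ofReal γ * ∫⁻ s', ∫⁻ a', ENNReal.ofReal |Q s' a' - qFunction γ r T π s' a'|
        ∂(π s') ∂(T z) := by
  have hd := abs_sub_le_of_mem_Icc hB hB'
  have hm : Measurable fun z : S × A => |Q z.1 z.2 - qFunction γ r T π z.1 z.2| :=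
    (hQ.sub (measurable_qFunction hγ0 hγ1 hr hC T π)).abs
  have hi : ∫⁻ s', ∫⁻ a', ENNReal.ofReal |Q s' a' - qFunction γ r T π s' a'| ∂(π s') ∂(T z) =
      ENNReal.ofReal
        (∫ z', |Q z'.1 z'.2 - qFunction γ r T π z'.1 z'.2| ∂(stepKernel T π z)) := by
    rw [ofReal_integral_eq_lintegral_ofReal (integrable_of_abs_le _ hm fun z => by
      rw [abs_abs]; exact hd _ _) (ae_of_all _ fun z => abs_nonneg _), stepKernel,
      Kernel.lintegral_compProd _ _ _ hm.ennreal_ofReal]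
    rfl
  rw [hi, ← ENNReal.ofReal_mul hγ0, ← ENNReal.ofReal_add (abs_nonneg _)
    (mul_nonneg hγ0 (integral_nonneg fun z => abs_nonneg _))]
  refine ENNReal.ofReal_le_ofReal ?_
  have := abs_bellman_sub_qFunction_le hγ0 hγ1 hr hC T π hQ hB hB' z
  linarith [abs_sub_le (Q z.1 z.2) (bellman γ r T π Q z.1 z.2) (qFunction γ r T π z.1 z.2)]

end QFunction

/-! ### Wasserstein distance on a bounded space -/

section Wasserstein

variable {A : Type*} [MetricSpace A] [MeasurableSpace A]

lemma wasserstein1_nonneg (μ ν : Measure A) : 0 ≤ wasserstein1 μ ν := ENNReal.toReal_nonneg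

lemma lintegral_edist_le_diam {μ : Measure A} [IsProbabilityMeasure μ]
    (hA : Bornology.IsBounded (Set.univ : Set A)) {c : Measure (A × A)}
    (hc : c.map Prod.fst = μ) :
    ∫⁻ p, edist p.1 p.2 ∂c ≤ ENNReal.ofReal (Metric.diam (Set.univ : Set A)) := by
  have hu : c Set.univ = 1 := by
    rw [← Set.preimage_univ (f := Prod.fst), ← Measure.map_apply measurable_fst MeasurableSet.univ,
      hc, measure_univ]
  calc ∫⁻ p, edist p.1 p.2 ∂c
      ≤ ∫⁻ _, ENNReal.ofReal (Metric.diam (Set.univ : Set A)) ∂c := lintegral_mono fun p => by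
        rw [edist_dist]
        exact ENNReal.ofReal_le_ofReal (Metric.dist_le_diam_of_mem hA trivial trivial)
    _ = _ := by rw [lintegral_const, hu, mul_one]

/-- `ν` is arbitrary because the behaviour policy can be degenerate at some states. Without a
coupling the infimum is `⊤`, and `toReal` sends it to 0. -/
lemma wasserstein1_le_diam (μ ν : Measure A) [IsProbabilityMeasure μ]
    (hA : Bornology.IsBounded (Set.univ : Set A)) :
    wasserstein1 μ ν ≤ Metric.diam (Set.univ : Set A) := by
  by_cases h : ∃ c : Measure (A × A), c.map Prod.fst = μ ∧ c.map Prod.snd = ν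
  · obtain ⟨c, hc1, hc2⟩ := h
    refine ENNReal.toReal_le_of_le_ofReal Metric.diam_nonneg ?_
    exact (iInf₂_le_of_le c hc1 (iInf_le _ hc2)).trans (lintegral_edist_le_diam hA hc1)
  · have : wasserstein1 μ ν = 0 := by
      have : (⨅ (c : Measure (A × A)) (_ : c.map Prod.fst = μ) (_ : c.map Prod.snd = ν),
          ∫⁻ p, edist p.1 p.2 ∂c) = ⊤ := by
        simp only [iInf_eq_top]
        exact fun c h1 h2 => (h ⟨c, h1, h2⟩).elim
      rw [wasserstein1, this, ENNReal.toReal_top]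
    rw [this]
    exact Metric.diam_nonneg

/-- The easy direction of Kantorovich duality. -/
lemma lintegral_sub_le_wasserstein1 [SecondCountableTopology A] [BorelSpace A]
    (μ ν : Measure A) [IsProbabilityMeasure μ] [IsProbabilityMeasure ν]
    (hA : Bornology.IsBounded (Set.univ : Set A)) {f : A → ℝ≥0∞} (hf : Measurable f) {K : ℝ≥0}
    (hK : ∀ x y, f x ≤ f y + K * edist x y) :
    ∫⁻ x, f x ∂μ - ∫⁻ x, f x ∂ν ≤ ENNReal.ofReal (K * wasserstein1 μ ν) := by
  have hcoupling (c : Measure (A × A)) (h1 : c.map Prod.fst = μ) (h2 : c.map Prod.snd = ν) :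
      ∫⁻ x, f x ∂μ - ∫⁻ x, f x ∂ν ≤ K * ∫⁻ p, edist p.1 p.2 ∂c := by
    rw [tsub_le_iff_left, ← h1, ← h2, lintegral_map hf measurable_fst,
      lintegral_map hf measurable_snd, ← lintegral_const_mul _ measurable_edist,
      ← lintegral_add_left (by fun_prop)]
    exact lintegral_mono fun p => hK _ _
  have hfst : (μ.prod ν).map Prod.fst = μ := Measure.map_fst_prod.trans (by simp)
  have hsnd : (μ.prod ν).map Prod.snd = ν := Measure.map_snd_prod.trans (by simp)
  -- The product coupling makes the infimum finite, so `toReal` loses nothing.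
  have hfin : (⨅ (c : Measure (A × A)) (_ : c.map Prod.fst = μ) (_ : c.map Prod.snd = ν),
      ∫⁻ p, edist p.1 p.2 ∂c) ≠ ⊤ :=
    ne_top_of_le_ne_top ENNReal.ofReal_ne_top (iInf_le_of_le (μ.prod ν)
      (iInf_le_of_le hfst (iInf_le_of_le hsnd (lintegral_edist_le_diam hA hfst))))
  rw [ENNReal.ofReal_mul K.coe_nonneg, wasserstein1, ENNReal.ofReal_toReal hfin,
    ENNReal.ofReal_coe_nnreal]
  rcases eq_or_ne K 0 with rfl | hK0
  · simpa using hcoupling _ hfst hsnd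
  · have hK0' : (K : ℝ≥0∞) ≠ 0 := ENNReal.coe_ne_zero.2 hK0
    simp_rw [ENNReal.mul_iInf_of_ne hK0' ENNReal.coe_ne_top]
    exact le_iInf fun c => le_iInf fun h1 => le_iInf fun h2 => hcoupling c h1 h2

end Wasserstein

/-- One-sided weighted Hoeffding inequality at confidence level `1 - δ / 2`. -/
lemma exists_measurableSet_sum_integral_le {Ω ι : Type*} [MeasurableSpace Ω] [Fintype ι]
    [Nonempty ι] {P : Measure Ω} [IsProbabilityMeasure P] {Z : ι → Ω → ℝ}
    (hZ : ∀ e, AEMeasurable (Z e) P) (hInd : iIndepFun Z P) {M : ℝ}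
    (hM : ∀ e ω, Z e ω ∈ Set.Icc 0 M) {w : ι → ℝ} (hw : ∀ e, 0 < w e)
    {δ : ℝ} (hδ0 : 0 < δ) (hδ1 : δ < 1) :
    ∃ G : Set Ω, MeasurableSet G ∧ 1 - δ < P.real G ∧ ∀ ω ∈ G,
      ∑ e, w e * ∫ ω', Z e ω' ∂P ≤
        ∑ e, w e * Z e ω + M * √((∑ e, w e ^ 2) / 2 * Real.log (2 / δ)) := by
  obtain ⟨ω₀⟩ : Nonempty Ω := P.nonempty_of_neZero
  have hM0 : 0 ≤ M :=
    let e := Classical.arbitrary ι; (hM e ω₀).1.trans (hM e ω₀).2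
  have hlog : 0 < Real.log (2 / δ) := Real.log_pos (by rw [lt_div_iff₀ hδ0]; linarith)
  have hw2 : 0 < ∑ e, w e ^ 2 :=
    Finset.sum_pos (fun e _ => pow_pos (hw e) 2) Finset.univ_nonempty
  rcases hM0.eq_or_lt with rfl | hMpos
  · have h0 (e : ι) (ω : Ω) : Z e ω = 0 := le_antisymm (hM e ω).2 (hM e ω).1
    exact ⟨Set.univ, MeasurableSet.univ, by simp [hδ0], fun ω _ => by simp [h0]⟩
  set t := M * √((∑ e, w e ^ 2) / 2 * Real.log (2 / δ)) with ht
  -- The sign is reversed because the sample sum must not fall far below its mean; each `-w e * Z e`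
  -- ranges over an interval of length `w e * M`.
  have hsub (e : ι) : HasSubgaussianMGF
      (fun ω => -w e * Z e ω - ∫ ω', -w e * Z e ω' ∂P) ((‖0 - -w e * M‖₊ / 2) ^ 2) P :=
    hasSubgaussianMGF_of_mem_Icc ((hZ e).const_mul _) <| ae_of_all _ fun ω =>
      ⟨mul_le_mul_of_nonpos_left (hM e ω).2 (by linarith [hw e]),
        mul_nonpos_of_nonpos_of_nonneg (by linarith [hw e]) (hM e ω).1⟩
  have hind : iIndepFun (fun e ω => -w e * Z e ω - ∫ ω', -w e * Z e ω' ∂P) P :=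
    hInd.comp (fun e x => -w e * x - ∫ ω', -w e * Z e ω' ∂P) fun e => by fun_prop
  have htail := HasSubgaussianMGF.measure_sum_ge_le_of_iIndepFun hind
    (s := Finset.univ) (fun e _ => hsub e) (show 0 ≤ t by positivity)
  -- `t` is chosen so that the tail is exactly `δ / 2`; this gives the strict inequality `1 - δ <
  -- P.real G`.
  have hexp : Real.exp (-t ^ 2 / (2 * (∑ e : ι, (‖0 - -w e * M‖₊ / 2) ^ 2 : ℝ≥0))) = δ / 2 := by
    have hden : (2 * (∑ e : ι, (‖0 - -w e * M‖₊ / 2) ^ 2 : ℝ≥0) : ℝ) =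
        M ^ 2 * ((∑ e, w e ^ 2) / 2) := by
      have h (e : ι) : ‖0 - -w e * M‖ = w e * M := by
        rw [neg_mul, sub_neg_eq_add, zero_add, Real.norm_of_nonneg (mul_pos (hw e) hMpos).le]
      push_cast
      simp_rw [h, div_pow, mul_pow, ← Finset.sum_div, ← Finset.sum_mul]
      ring
    rw [hden, ht, mul_pow, Real.sq_sqrt (by positivity), neg_div,
      mul_div_mul_left _ _ (by positivity), mul_div_cancel_left₀ _ (by positivity),
      Real.exp_neg, Real.exp_log (by positivity), inv_div]
  have hmeas : NullMeasurableSet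
      {ω | t ≤ ∑ e, (-w e * Z e ω - ∫ ω', -w e * Z e ω' ∂P)} P :=
    nullMeasurableSet_le aemeasurable_const
      (Finset.aemeasurable_fun_sum _ fun e _ => ((hZ e).const_mul _).sub_const _)
  -- The `Z e` are only a.e. measurable, so the good event is shrunk by a null set to a measurable
  -- one.
  obtain ⟨G, hGs, hG, hGae⟩ := hmeas.compl.exists_measurable_subset_ae_eq
  refine ⟨G, hG, ?_, fun ω hω => ?_⟩
  · rw [measureReal_congr hGae, probReal_compl_eq_one_sub₀ hmeas]
    have := htail.trans_eq hexp
    linarith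
  · have h := hGs hω
    simp only [Set.mem_compl_iff, Set.mem_ofPred_eq, not_le] at h
    have : ∑ e, (-w e * Z e ω - ∫ ω', -w e * Z e ω' ∂P) =
        ∑ e, w e * ∫ ω', Z e ω' ∂P - ∑ e, w e * Z e ω := by
      rw [← Finset.sum_sub_distrib]
      exact Finset.sum_congr rfl fun e _ => by rw [integral_const_mul]; ring
    linarith

/-! ### The behaviour policy and the deterministic bound -/

section Behavior

variable {S A : Type*} [MeasurableSpace S] [MeasurableSpace A] {N : ℕ}
  (ν : Measure S) (γ : ℝ) (ρ₀ : Measure S) (T : Kernel (S × A) S)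
  (π : Fin N → Kernel S A) [IsMarkovKernel T] [∀ e, IsMarkovKernel (π e)] (w : Fin N → ℝ)

/-- The denominator of the behaviour policy. -/
noncomputable def mixtureDensity (s : S) : ℝ≥0∞ :=
  ∑ e, ENNReal.ofReal (w e) * occupancyDensity ν γ ρ₀ T (π e) s

@[fun_prop]
lemma measurable_occupancyDensity (e : Fin N) :
    Measurable (occupancyDensity ν γ ρ₀ T (π e)) := Measure.measurable_rnDeriv _ _

@[fun_prop]
lemma measurable_mixtureDensity : Measurable (mixtureDensity ν γ ρ₀ T π w) := by
  unfold mixtureDensity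
  fun_prop

lemma lintegral_behaviorPolicy (s : S) (f : A → ℝ≥0∞) :
    ∫⁻ a, f a ∂(behaviorPolicy ν γ ρ₀ T π w s) =
      ∑ e, ENNReal.ofReal (w e) * occupancyDensity ν γ ρ₀ T (π e) s /
        mixtureDensity ν γ ρ₀ T π w s * ∫⁻ a, f a ∂(π e s) := by
  rw [behaviorPolicy, lintegral_finsetSum_measure]
  simp_rw [lintegral_smul_measure, smul_eq_mul]
  rfl

/-- The behaviour policy is not packaged as a kernel; measurability comes from its explicit form as
a finite combination of kernels. -/
lemma measurable_lintegral_behaviorPolicy {f : S × A → ℝ≥0∞} (hf : Measurable f) :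
    Measurable fun s => ∫⁻ a, f (s, a) ∂(behaviorPolicy ν γ ρ₀ T π w s) := by
  simp_rw [lintegral_behaviorPolicy]
  have h (e : Fin N) : Measurable fun s => ∫⁻ a, f (s, a) ∂(π e s) :=
    hf.lintegral_kernel_prod_right'
  fun_prop

lemma behaviorPolicy_univ (s : S) :
    behaviorPolicy ν γ ρ₀ T π w s Set.univ =
      mixtureDensity ν γ ρ₀ T π w s / mixtureDensity ν γ ρ₀ T π w s := by
  rw [← lintegral_one, lintegral_behaviorPolicy]
  simp only [lintegral_one, measure_univ, mul_one, div_eq_mul_inv]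
  rw [← Finset.sum_mul]
  rfl

lemma behaviorPolicy_univ_le_one (s : S) : behaviorPolicy ν γ ρ₀ T π w s Set.univ ≤ 1 := by
  rw [behaviorPolicy_univ]
  exact ENNReal.div_self_le_one

lemma isProbabilityMeasure_behaviorPolicy {s : S} (h0 : mixtureDensity ν γ ρ₀ T π w s ≠ 0)
    (htop : mixtureDensity ν γ ρ₀ T π w s ≠ ⊤) :
    IsProbabilityMeasure (behaviorPolicy ν γ ρ₀ T π w s) :=
  ⟨by rw [behaviorPolicy_univ, ENNReal.div_self h0 htop]⟩

variable [SigmaFinite ν] [IsProbabilityMeasure ρ₀] (hρ₀ : ρ₀ ≪ ν) (hT : ∀ x, T x ≪ ν)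
  (hγ0 : 0 ≤ γ) (hγ1 : γ < 1)

omit [SigmaFinite ν] in
include hγ0 hγ1 in
lemma ae_mixtureDensity_ne_top : ∀ᵐ s ∂ν, mixtureDensity ν γ ρ₀ T π w s ≠ ⊤ := by
  have h : ∀ᵐ s ∂ν, ∀ e, occupancyDensity ν γ ρ₀ T (π e) s ≠ ⊤ := ae_all_iff.2 fun e => by
    have := occupancy_isProbabilityMeasure γ ρ₀ T (π e) hγ0 hγ1
    exact Measure.rnDeriv_ne_top _ _
  filter_upwards [h] with s hs
  exact ENNReal.sum_ne_top.2 fun e _ => ENNReal.mul_ne_top ENNReal.ofReal_ne_top (hs e)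

include hρ₀ hT hγ0 hγ1

lemma withDensity_occupancyDensity (e : Fin N) :
    ν.withDensity (occupancyDensity ν γ ρ₀ T (π e)) = occupancy γ ρ₀ T (π e) := by
  have := occupancy_isProbabilityMeasure γ ρ₀ T (π e) hγ0 hγ1
  exact Measure.withDensity_rnDeriv_eq _ _
    (occupancy_absolutelyContinuous γ ρ₀ T (π e) hρ₀ hT)

/-- Where the mixture density vanishes, so does the density of each occupancy measure, since all
weights are positive. -/
lemma ae_occupancy_mixtureDensity (hw : ∀ e, 0 < w e) (e : Fin N) :
    ∀ᵐ s ∂(occupancy γ ρ₀ T (π e)),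
      mixtureDensity ν γ ρ₀ T π w s ≠ 0 ∧ mixtureDensity ν γ ρ₀ T π w s ≠ ⊤ := by
  rw [← withDensity_occupancyDensity ν γ ρ₀ T π hρ₀ hT hγ0 hγ1 e,
    ae_withDensity_iff (by fun_prop)]
  filter_upwards [ae_mixtureDensity_ne_top ν γ ρ₀ T π w hγ0 hγ1] with s hs h
  refine ⟨fun h0 => ?_, hs⟩
  have := Finset.sum_eq_zero_iff.1 h0 e (Finset.mem_univ e)
  rcases mul_eq_zero.1 this with h' | h'
  · exact absurd h' (ENNReal.ofReal_pos.2 (hw e)).ne'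
  · exact h h'

/-- Under the mixture of the occupancy measures, the behaviour policy is the conditional law of
the action given the state. -/
lemma sum_lintegral_behaviorPolicy {f : S × A → ℝ≥0∞} (hf : Measurable f) :
    ∑ e, ENNReal.ofReal (w e) *
        ∫⁻ s, ∫⁻ a, f (s, a) ∂(behaviorPolicy ν γ ρ₀ T π w s) ∂(occupancy γ ρ₀ T (π e)) =
      ∑ e, ENNReal.ofReal (w e) *
        ∫⁻ s, ∫⁻ a, f (s, a) ∂(π e s) ∂(occupancy γ ρ₀ T (π e)) := by
  have key (g : Fin N → S → ℝ≥0∞) (hg : ∀ e, Measurable (g e)) :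
      ∑ e, ENNReal.ofReal (w e) * ∫⁻ s, g e s ∂(occupancy γ ρ₀ T (π e)) =
        ∫⁻ s, ∑ e, ENNReal.ofReal (w e) * occupancyDensity ν γ ρ₀ T (π e) s * g e s ∂ν := by
    rw [lintegral_finsetSum _ fun e _ => by have := hg e; fun_prop]
    refine Finset.sum_congr rfl fun e _ => ?_
    have := hg e
    rw [← withDensity_occupancyDensity ν γ ρ₀ T π hρ₀ hT hγ0 hγ1 e,
      lintegral_withDensity_eq_lintegral_mul _ (by fun_prop) (hg e),
      ← lintegral_const_mul _ (by fun_prop)]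
    simp [mul_assoc]
  rw [key _ fun _ => measurable_lintegral_behaviorPolicy ν γ ρ₀ T π w hf,
    key (fun e s => ∫⁻ a, f (s, a) ∂(π e s)) fun e => hf.lintegral_kernel_prod_right']
  refine lintegral_congr_ae ?_
  filter_upwards [ae_mixtureDensity_ne_top ν γ ρ₀ T π w hγ0 hγ1] with s hs
  rw [← Finset.sum_mul, lintegral_behaviorPolicy, Finset.mul_sum]
  refine Finset.sum_congr rfl fun e _ => ?_
  rw [← mul_assoc]
  congr 1
  change mixtureDensity ν γ ρ₀ T π w s * _ = _
  -- A vanishing denominator is harmless: each numerator is one of its summands and vanishes too.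
  refine ENNReal.mul_div_cancel' (fun h0 => ?_) (fun h => absurd h hs)
  exact Finset.sum_eq_zero_iff.1 h0 e (Finset.mem_univ e)

/-- A Bellman-type inequality for `f` with error `ε`, and the comparison of the target policy with
the behaviour policy up to `k`, bound the mean of `f` under the initial distribution and the
behaviour policy by the means of `ε` and `k` under the occupancy measures. -/
lemma lintegral_behaviorPolicy_le (hw : ∀ e, 0 < w e) (πN : Kernel S A) [IsMarkovKernel πN]
    {f ε : S × A → ℝ≥0∞} {k : S → ℝ≥0∞} (hf : Measurable f) (hε : Measurable ε)
    {b : ℝ≥0∞} (hb : b ≠ ⊤) (hfb : ∀ z, f z ≤ b)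
    (hfε : ∀ z, f z ≤ ε z + ENNReal.ofReal γ * ∫⁻ s', ∫⁻ a', f (s', a') ∂(πN s') ∂(T z))
    (hfk : ∀ s, mixtureDensity ν γ ρ₀ T π w s ≠ 0 → mixtureDensity ν γ ρ₀ T π w s ≠ ⊤ →
      ∫⁻ a, f (s, a) ∂(πN s) ≤ ∫⁻ a, f (s, a) ∂(behaviorPolicy ν γ ρ₀ T π w s) + k s) :
    (∑ e, ENNReal.ofReal (w e)) * (ENNReal.ofReal (1 - γ) *
        ∫⁻ s, ∫⁻ a, f (s, a) ∂(behaviorPolicy ν γ ρ₀ T π w s) ∂ρ₀) ≤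
      ∑ e, ENNReal.ofReal (w e) *
        ∫⁻ s, ∫⁻ a, (ε (s, a) + k s) ∂(π e s) ∂(occupancy γ ρ₀ T (π e)) := by
  set hD : S → ℝ≥0∞ := fun s => ∫⁻ a, f (s, a) ∂(behaviorPolicy ν γ ρ₀ T π w s) with hD_def
  have hDm : Measurable hD := measurable_lintegral_behaviorPolicy ν γ ρ₀ T π w hf
  have hNm : Measurable fun s => ∫⁻ a, f (s, a) ∂(πN s) := hf.lintegral_kernel_prod_right'
  have hstep (e : Fin N) :
      ∫⁻ s, ∫⁻ a, f (s, a) ∂(π e s) ∂(occupancy γ ρ₀ T (π e)) +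
          ENNReal.ofReal (1 - γ) * ∫⁻ s, hD s ∂ρ₀ ≤
        ∫⁻ s, hD s ∂(occupancy γ ρ₀ T (π e)) +
          ∫⁻ s, ∫⁻ a, (ε (s, a) + k s) ∂(π e s) ∂(occupancy γ ρ₀ T (π e)) := by
    have := occupancy_isProbabilityMeasure γ ρ₀ T (π e) hγ0 hγ1
    set o := occupancy γ ρ₀ T (π e) with ho
    have hflow : o = ENNReal.ofReal (1 - γ) • ρ₀ + ENNReal.ofReal γ • (T ∘ₘ (o.compProd (π e))) :=
      occupancy_eq γ ρ₀ T (π e) hγ0 hγ1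
    have hεm : Measurable fun s => ∫⁻ a, ε (s, a) ∂(π e s) := hε.lintegral_kernel_prod_right'
    have h1 : ∫⁻ s, ∫⁻ a, f (s, a) ∂(π e s) ∂o ≤ ∫⁻ s, ∫⁻ a, ε (s, a) ∂(π e s) ∂o +
        ENNReal.ofReal γ * ∫⁻ s, ∫⁻ a, f (s, a) ∂(πN s) ∂(T ∘ₘ (o.compProd (π e))) := by
      rw [Measure.lintegral_bind (by fun_prop) hNm.aemeasurable, ← Measure.lintegral_compProd hf,
        ← Measure.lintegral_compProd hε, ← lintegral_const_mul _ hNm.lintegral_kernel,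
        ← lintegral_add_left hε]
      exact lintegral_mono hfε
    have h2 : ENNReal.ofReal γ * ∫⁻ s, ∫⁻ a, f (s, a) ∂(πN s) ∂(T ∘ₘ (o.compProd (π e))) ≤
        ENNReal.ofReal γ * ∫⁻ s, (hD s + k s) ∂(T ∘ₘ (o.compProd (π e))) := by
      rw [← smul_eq_mul, ← smul_eq_mul, ← lintegral_smul_measure, ← lintegral_smul_measure]
      refine lintegral_mono_ae ?_
      -- By the flow equation the scaled next-state law is a summand of the occupancy measure, so it
      -- inherits its almost-sure statements.
      have hae := ae_occupancy_mixtureDensity ν γ ρ₀ T π w hρ₀ hT hγ0 hγ1 hw e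
      rw [← ho, hflow, ae_add_measure_iff] at hae
      filter_upwards [hae.2] with s hs
      exact hfk s hs.1 hs.2
    have h3 : ∫⁻ s, (hD s + k s) ∂o = ENNReal.ofReal (1 - γ) * ∫⁻ s, (hD s + k s) ∂ρ₀ +
        ENNReal.ofReal γ * ∫⁻ s, (hD s + k s) ∂(T ∘ₘ (o.compProd (π e))) := by
      conv_lhs => rw [hflow]
      rw [lintegral_add_measure, lintegral_smul_measure, lintegral_smul_measure, smul_eq_mul,
        smul_eq_mul]
    have h4 : ∫⁻ s, ∫⁻ a, (ε (s, a) + k s) ∂(π e s) ∂o =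
        ∫⁻ s, ∫⁻ a, ε (s, a) ∂(π e s) ∂o + ∫⁻ s, k s ∂o := by
      rw [← lintegral_add_left hεm]
      refine lintegral_congr fun s => ?_
      rw [lintegral_add_right _ measurable_const, lintegral_const, measure_univ, mul_one]
    have h5 : ENNReal.ofReal (1 - γ) * ∫⁻ s, hD s ∂ρ₀ ≤
        ENNReal.ofReal (1 - γ) * ∫⁻ s, (hD s + k s) ∂ρ₀ := by
      gcongr
      exact le_self_add
    rw [lintegral_add_left hDm] at h3
    calc _ ≤ ∫⁻ s, ∫⁻ a, ε (s, a) ∂(π e s) ∂o +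
          ENNReal.ofReal γ * ∫⁻ s, (hD s + k s) ∂(T ∘ₘ (o.compProd (π e))) +
          ENNReal.ofReal (1 - γ) * ∫⁻ s, (hD s + k s) ∂ρ₀ :=
        add_le_add (h1.trans (by gcongr)) h5
      _ = ∫⁻ s, ∫⁻ a, ε (s, a) ∂(π e s) ∂o + (∫⁻ s, hD s ∂o + ∫⁻ s, k s ∂o) := by
        rw [h3]; ring
      _ = _ := by rw [h4]; ring
  have hsum := Finset.sum_le_sum fun e (_ : e ∈ Finset.univ) =>
    mul_le_mul_right (hstep e) (ENNReal.ofReal (w e))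
  simp_rw [mul_add, Finset.sum_add_distrib] at hsum
  rw [sum_lintegral_behaviorPolicy ν γ ρ₀ T π w hρ₀ hT hγ0 hγ1 hf, ← Finset.sum_mul] at hsum
  -- The common term, the weighted mean of `f`, may be cancelled because it is finite: `f ≤ b`.
  refine (ENNReal.add_le_add_iff_left ?_).1 hsum
  refine ENNReal.sum_ne_top.2 fun e _ => ENNReal.mul_ne_top ENNReal.ofReal_ne_top ?_
  have := occupancy_isProbabilityMeasure γ ρ₀ T (π e) hγ0 hγ1
  refine ne_top_of_le_ne_top hb ?_
  calc _ ≤ ∫⁻ s, ∫⁻ a, b ∂(π e s) ∂(occupancy γ ρ₀ T (π e)) :=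
        lintegral_mono fun s => lintegral_mono fun a => hfb _
    _ = b := by simp

end Behavior

/-! ### Discounted sums along sampled trajectories -/

section Empirical

variable {S A : Type*} {γ : ℝ}

/-- The discounted average of `f` along the trajectory `x`. -/
noncomputable def discountedSum (γ : ℝ) (f : S × A → ℝ≥0∞) (x : ℕ → S × A) : ℝ≥0∞ :=
  ∑' i : ℕ, ENNReal.ofReal ((1 - γ) * γ ^ i) * f (x i)

lemma measurable_discountedSum [MeasurableSpace S] [MeasurableSpace A] {f : S × A → ℝ≥0∞}
    (hf : Measurable f) : Measurable (discountedSum γ f) :=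
  Measurable.tsum fun i => (hf.comp (measurable_pi_apply i)).const_mul _

lemma discountedSum_le (hγ0 : 0 ≤ γ) (hγ1 : γ < 1) {f : S × A → ℝ≥0∞} {b : ℝ≥0∞}
    (hf : ∀ z, f z ≤ b) (x : ℕ → S × A) : discountedSum γ f x ≤ b := by
  calc discountedSum γ f x ≤ ∑' i : ℕ, ENNReal.ofReal ((1 - γ) * γ ^ i) * b :=
        ENNReal.tsum_le_tsum fun i => mul_le_mul_right (hf _) _
    _ = b := by rw [ENNReal.tsum_mul_right, tsum_ofReal_discount γ hγ0 hγ1, one_mul]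

lemma summable_discount_mul (hγ0 : 0 ≤ γ) (hγ1 : γ < 1) {u : ℕ → ℝ} {C : ℝ}
    (hu : ∀ i, |u i| ≤ C) : Summable fun i => (1 - γ) * γ ^ i * u i := by
  simpa only [mul_assoc] using (summable_discounted hγ0 hγ1 hu).mul_left (1 - γ)

lemma toReal_discountedSum_le (hγ0 : 0 ≤ γ) (hγ1 : γ < 1) {f : S × A → ℝ≥0∞} {g : S × A → ℝ}
    {C : ℝ} (hg0 : ∀ z, 0 ≤ g z) (hgC : ∀ z, g z ≤ C) (hfg : ∀ z, f z ≤ ENNReal.ofReal (g z))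
    (x : ℕ → S × A) :
    (discountedSum γ f x).toReal ≤ ∑' i : ℕ, (1 - γ) * γ ^ i * g (x i) := by
  have h1 : 0 ≤ 1 - γ := sub_nonneg.2 hγ1.le
  have hnn (i : ℕ) : 0 ≤ (1 - γ) * γ ^ i * g (x i) := mul_nonneg (by positivity) (hg0 _)
  refine ENNReal.toReal_le_of_le_ofReal (tsum_nonneg hnn) ?_
  rw [ENNReal.ofReal_tsum_of_nonneg hnn (summable_discount_mul hγ0 hγ1 fun i =>
    (abs_of_nonneg (hg0 _)).trans_le (hgC _))]
  refine ENNReal.tsum_le_tsum fun i => ?_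
  rw [ENNReal.ofReal_mul (show 0 ≤ (1 - γ) * γ ^ i by positivity)]
  exact mul_le_mul_right (hfg _) _

lemma sum_mul_weightedAverage [MeasurableSpace S] [MeasurableSpace A] {N : ℕ} {w : Fin N → ℝ}
    (hw : ∑ e, w e ≠ 0) (x : Fin N → ℕ → S × A) (f : S → A → ℝ) :
    (∑ e, w e) * weightedAverage γ w x f =
      ∑ e, w e * ∑' i : ℕ, (1 - γ) * γ ^ i * f (x e i).1 (x e i).2 := by
  rw [weightedAverage, ← mul_assoc, mul_one_div_cancel hw, one_mul]
  refine Finset.sum_congr rfl fun e _ => ?_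
  rw [← tsum_mul_left]
  exact tsum_congr fun i => by ring

lemma integral_discountedSum [MeasurableSpace S] [MeasurableSpace A] {Ω : Type*}
    [MeasurableSpace Ω] {P : Measure Ω} (hγ0 : 0 ≤ γ) (hγ1 : γ < 1)
    {ρ₀ : Measure S} [IsProbabilityMeasure ρ₀] {T : Kernel (S × A) S} {π : Kernel S A}
    [IsMarkovKernel T] [IsMarkovKernel π] {X : Ω → ℕ → S × A}
    (hX : HasLaw X (pathLaw ρ₀ T π) P) {f : S × A → ℝ≥0∞} (hf : Measurable f) {b : ℝ≥0∞}
    (hb : b ≠ ⊤) (hfb : ∀ z, f z ≤ b) :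
    ∫ ω, (discountedSum γ f (X ω)).toReal ∂P =
      (∫⁻ s, ∫⁻ a, f (s, a) ∂(π s) ∂(occupancy γ ρ₀ T π)).toReal := by
  have hm := measurable_discountedSum (γ := γ) hf
  rw [← integral_map hX.aemeasurable (f := fun x => (discountedSum γ f x).toReal)
    hm.ennreal_toReal.aestronglyMeasurable, hX.map_eq,
    integral_toReal hm.aemeasurable (ae_of_all _ fun x =>
      (discountedSum_le hγ0 hγ1 hfb x).trans_lt hb.lt_top)]
  exact congrArg _ (lintegral_discounted_sum γ ρ₀ T π hf)

end Empirical

lemma ofReal_abs_sub_le_of_lipschitz {A : Type*} [MetricSpace A] {L : ℝ≥0} {f g : A → ℝ}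
    (hf : LipschitzWith L f) (hg : LipschitzWith L g) (x y : A) :
    ENNReal.ofReal |f x - g x| ≤
      ENNReal.ofReal |f y - g y| + ((2 * L : ℝ≥0) : ℝ≥0∞) * edist x y := by
  have h := (abs_sub_abs_le_abs_sub (f x - g x) (f y - g y)).trans
    (Real.dist_eq _ _ ▸ (hf.sub hg).dist_le_mul x y)
  rw [edist_dist, ← ENNReal.ofReal_coe_nnreal, ← ENNReal.ofReal_mul (NNReal.coe_nonneg _),
    ← ENNReal.ofReal_add (abs_nonneg _) (by positivity)]
  refine ENNReal.ofReal_le_ofReal ?_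
  rw [← two_mul] at h
  linarith

/-! ### A measurable substitute for the Wasserstein term -/

section Gap

variable {S A : Type*} [MeasurableSpace S] [MeasurableSpace A] {N : ℕ}
  (ν : Measure S) (γ : ℝ) (ρ₀ : Measure S) (T : Kernel (S × A) S)
  (π : Fin N → Kernel S A) [IsMarkovKernel T] [∀ e, IsMarkovKernel (π e)] (w : Fin N → ℝ)
  (πN : Kernel S A) [IsMarkovKernel πN]

/-- The excess of the mean of `f` under `πN` over its mean under the behaviour policy, where the
latter is a probability measure. -/
noncomputable def policyGap (f : S × A → ℝ≥0∞) : S → ℝ≥0∞ :=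
  Set.indicator {s | mixtureDensity ν γ ρ₀ T π w s ≠ 0 ∧ mixtureDensity ν γ ρ₀ T π w s ≠ ⊤}
    fun s => ∫⁻ a, f (s, a) ∂(πN s) - ∫⁻ a, f (s, a) ∂(behaviorPolicy ν γ ρ₀ T π w s)

lemma measurable_policyGap {f : S × A → ℝ≥0∞} (hf : Measurable f) :
    Measurable (policyGap ν γ ρ₀ T π w πN f) := by
  have hm := measurable_mixtureDensity ν γ ρ₀ T π w
  refine Measurable.indicator ?_ ?_
  · exact hf.lintegral_kernel_prod_right'.sub
      (measurable_lintegral_behaviorPolicy ν γ ρ₀ T π w hf)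
  · exact ((hm (measurableSet_singleton 0)).compl).inter (hm (measurableSet_singleton ⊤)).compl

omit [IsMarkovKernel πN] in
lemma lintegral_le_add_policyGap (f : S × A → ℝ≥0∞) (s : S)
    (h0 : mixtureDensity ν γ ρ₀ T π w s ≠ 0) (htop : mixtureDensity ν γ ρ₀ T π w s ≠ ⊤) :
    ∫⁻ a, f (s, a) ∂(πN s) ≤
      ∫⁻ a, f (s, a) ∂(behaviorPolicy ν γ ρ₀ T π w s) + policyGap ν γ ρ₀ T π w πN f s := by
  have hs : s ∈ {s | mixtureDensity ν γ ρ₀ T π w s ≠ 0 ∧ mixtureDensity ν γ ρ₀ T π w s ≠ ⊤} :=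
    ⟨h0, htop⟩
  rw [policyGap, Set.indicator_of_mem hs]
  exact le_add_tsub

/-- Duality needs two probability measures; elsewhere the indicator makes the gap 0, which matters
since `wasserstein1` may there be the default 0. -/
lemma policyGap_le {A : Type*} [MetricSpace A] [SecondCountableTopology A] [MeasurableSpace A]
    [BorelSpace A] (T : Kernel (S × A) S) (π : Fin N → Kernel S A) [IsMarkovKernel T]
    [∀ e, IsMarkovKernel (π e)] (πN : Kernel S A) [IsMarkovKernel πN]
    (hA : Bornology.IsBounded (Set.univ : Set A)) {f : S × A → ℝ≥0∞} (hf : Measurable f)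
    {K : ℝ≥0} (hK : ∀ s x y, f (s, x) ≤ f (s, y) + K * edist x y) (s : S) :
    policyGap ν γ ρ₀ T π w πN f s ≤
      ENNReal.ofReal (K * wasserstein1 (πN s) (behaviorPolicy ν γ ρ₀ T π w s)) := by
  refine Set.indicator_apply_le' (fun hs => ?_) fun _ => zero_le
  have := isProbabilityMeasure_behaviorPolicy ν γ ρ₀ T π w hs.1 hs.2
  exact lintegral_sub_le_wasserstein1 _ _ hA (hf.comp measurable_prodMk_left) (hK s)

lemma integral_behaviorPolicy_eq_toReal {g : S × A → ℝ} (hg : Measurable g) {B : ℝ}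
    (hg0 : ∀ z, 0 ≤ g z) (hgB : ∀ z, g z ≤ B) :
    ∫ s, ∫ a, g (s, a) ∂(behaviorPolicy ν γ ρ₀ T π w s) ∂ρ₀ =
      (∫⁻ s, ∫⁻ a, ENNReal.ofReal (g (s, a)) ∂(behaviorPolicy ν γ ρ₀ T π w s) ∂ρ₀).toReal := by
  have h (s : S) : ∫ a, g (s, a) ∂(behaviorPolicy ν γ ρ₀ T π w s) =
      (∫⁻ a, ENNReal.ofReal (g (s, a)) ∂(behaviorPolicy ν γ ρ₀ T π w s)).toReal :=
    integral_eq_lintegral_of_nonneg_ae (ae_of_all _ fun a => hg0 _)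
      (hg.comp measurable_prodMk_left).aestronglyMeasurable
  simp_rw [h]
  refine integral_toReal (measurable_lintegral_behaviorPolicy ν γ ρ₀ T π w
    hg.ennreal_ofReal).aemeasurable (ae_of_all _ fun s => ?_)
  calc _ ≤ ∫⁻ a, ENNReal.ofReal B ∂(behaviorPolicy ν γ ρ₀ T π w s) :=
        lintegral_mono fun a => ENNReal.ofReal_le_ofReal (hgB _)
    _ ≤ ENNReal.ofReal B * 1 := by
        rw [lintegral_const]
        gcongr
        exact behaviorPolicy_univ_le_one ν γ ρ₀ T π w s
    _ < ⊤ := by simp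

end Gap

end OffPolicy

/-! ### Combination of the deterministic bound with concentration -/

theorem theorem2 {S A Ω : Type*} [MeasurableSpace S]
    [MetricSpace A] [SecondCountableTopology A] [MeasurableSpace A] [BorelSpace A]
    [MeasurableSpace Ω]
    -- the MDP: reference measure, initial distribution, transition law, reward, discount factor
    (ν : Measure S) [SigmaFinite ν]
    (ρ₀ : Measure S) [IsProbabilityMeasure ρ₀] (hρ₀ : ρ₀ ≪ ν)
    (T : Kernel (S × A) S) [IsMarkovKernel T] (hT : ∀ x, T x ≪ ν)
    (r : S → A → ℝ) (hr : Measurable (Function.uncurry r)) (hrb : ∃ C : ℝ, ∀ s a, |r s a| ≤ C)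
    (γ : ℝ) (hγ0 : 0 < γ) (hγ1 : γ < 1)
    -- the policies and the positive weights of the episodes
    (N : ℕ) (hN : 0 < N)
    (π : Fin N → Kernel S A) [∀ e, IsMarkovKernel (π e)]
    (w : Fin N → ℝ) (hw : ∀ e, 0 < w e)
    -- the policy of the last episode
    (πN : Kernel S A) [IsMarkovKernel πN] (hπN : πN = π ⟨N - 1, Nat.sub_lt hN Nat.one_pos⟩)
    -- the estimate of the Q function, and the three assumptions
    (Qhat : S → A → ℝ) (hQ : Measurable (Function.uncurry Qhat))
    (rmax : ℝ) (L : ℝ≥0)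
    (hLip : ∀ s, LipschitzWith L (Qhat s))
    (hLipN : ∀ s, LipschitzWith L (OffPolicy.qFunction γ r T πN s))
    (hRange : ∀ s a, Qhat s a ∈ Set.Icc 0 (rmax / (1 - γ)))
    (hRangeN : ∀ s a, OffPolicy.qFunction γ r T πN s a ∈ Set.Icc 0 (rmax / (1 - γ)))
    (hA : Bornology.IsBounded (Set.univ : Set A))
    -- the sampled trajectories, one for each episode
    (P : Measure Ω) [IsProbabilityMeasure P]
    (X : Fin N → Ω → ℕ → S × A)
    (hX : ∀ e, HasLaw (X e) (OffPolicy.pathLaw ρ₀ T (π e)) P)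
    (hInd : iIndepFun X P)
    (δ : ℝ) (hδ0 : 0 < δ) (hδ1 : δ < 1) :
    ∃ G : Set Ω, MeasurableSet G ∧ 1 - δ < P.real G ∧ ∀ ω ∈ G,
      ∫ s, ∫ a, |Qhat s a - OffPolicy.qFunction γ r T πN s a|
          ∂(OffPolicy.behaviorPolicy ν γ ρ₀ T π w s) ∂ρ₀
        ≤ rmax / (1 - γ) *
            √((∑ e, w e ^ 2) / (2 * (∑ e, w e) ^ 2) * Real.log (2 / δ))
          + (rmax / (1 - γ) ^ 2 + 2 * L * Metric.diam (Set.univ : Set A) / (1 - γ)) *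
            √(2 * (∑ e, w e ^ 2) / (∑ e, w e) ^ 2 * Real.log (2 / δ))
          + 1 / (1 - γ) *
            (OffPolicy.weightedAverage γ w (fun e => X e ω)
                (fun s a => |Qhat s a - OffPolicy.bellman γ r T πN Qhat s a|)
              + 2 * L * OffPolicy.weightedAverage γ w (fun e => X e ω)
                (fun s _ => OffPolicy.wasserstein1 (πN s)
                  (OffPolicy.behaviorPolicy ν γ ρ₀ T π w s))) := by

  obtain ⟨C, hC⟩ := hrb
  have : Nonempty (Fin N) := ⟨⟨0, hN⟩⟩
  obtain ⟨s₀⟩ : Nonempty S := ρ₀.nonempty_of_neZero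
  obtain ⟨a₀⟩ : Nonempty A := (πN s₀).nonempty_of_neZero
  have hγ0' := hγ0.le
  have hγ : 0 < 1 - γ := sub_pos.2 hγ1
  set B := rmax / (1 - γ) with hB
  set d := Metric.diam (Set.univ : Set A) with hd
  have hB0 : 0 ≤ B := (hRange s₀ a₀).1.trans (hRange s₀ a₀).2
  have hd0 : 0 ≤ d := Metric.diam_nonneg
  set q := OffPolicy.qFunction γ r T πN with hq
  set g : S × A → ℝ := fun z => |Qhat z.1 z.2 - q z.1 z.2| with hg
  set b : S × A → ℝ := fun z => |Qhat z.1 z.2 - OffPolicy.bellman γ r T πN Qhat z.1 z.2| with hb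
  set W1 : S → ℝ := fun s =>
    OffPolicy.wasserstein1 (πN s) (OffPolicy.behaviorPolicy ν γ ρ₀ T π w s) with hW1
  have hgB (z : S × A) : g z ≤ B := OffPolicy.abs_sub_le_of_mem_Icc hRange hRangeN _ _
  have hgm : Measurable g :=
    (hQ.sub (OffPolicy.measurable_qFunction hγ0' hγ1 hr hC T πN)).abs
  have hQB (s : S) (a : A) : |Qhat s a| ≤ B :=
    (abs_of_nonneg (hRange s a).1).trans_le (hRange s a).2
  have hbm : Measurable b := (hQ.sub (OffPolicy.measurable_bellman hr T πN hQ hQB)).abs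
  have hbB (z : S × A) : b z ≤ 2 * B :=
    OffPolicy.abs_sub_bellman_le hγ0' hγ1 hr hC T πN hQ hRange hRangeN _ _
  have hW0 (s : S) : 0 ≤ W1 s := OffPolicy.wasserstein1_nonneg _ _
  have hWd (s : S) : W1 s ≤ d := OffPolicy.wasserstein1_le_diam _ _ hA
  set f : S × A → ℝ≥0∞ := fun z => ENNReal.ofReal (g z) with hf
  have hfm : Measurable f := hgm.ennreal_ofReal
  set k := OffPolicy.policyGap ν γ ρ₀ T π w πN f with hk
  have hkm : Measurable k := OffPolicy.measurable_policyGap ν γ ρ₀ T π w πN hfm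
  have hkW (s : S) : k s ≤ ENNReal.ofReal (2 * L * W1 s) := by
    simpa using OffPolicy.policyGap_le ν γ ρ₀ w T π πN hA hfm (K := 2 * L)
      (fun s => OffPolicy.ofReal_abs_sub_le_of_lipschitz (hLip s) (hLipN s)) s
  set F : S × A → ℝ≥0∞ := fun z => ENNReal.ofReal (b z) + k z.1 with hF
  have hFm : Measurable F := hbm.ennreal_ofReal.add (hkm.comp measurable_fst)
  have hFle (z : S × A) : F z ≤ ENNReal.ofReal (b z + 2 * L * W1 z.1) := by
    rw [ENNReal.ofReal_add (abs_nonneg _) (mul_nonneg (by positivity) (hW0 _))]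
    exact add_le_add le_rfl (hkW _)
  -- Range of `ε + k`: the Bellman error is at most `2 * B`, the gap at most `2 * L * d`.
  set M := 2 * B + 2 * L * d with hM
  have hLW (s : S) : 2 * L * W1 s ≤ 2 * L * d := mul_le_mul_of_nonneg_left (hWd s) (by positivity)
  have hLW0 (s : S) : 0 ≤ 2 * L * W1 s := mul_nonneg (by positivity) (hW0 s)
  have hFM (z : S × A) : F z ≤ ENNReal.ofReal M :=
    (hFle z).trans (ENNReal.ofReal_le_ofReal (add_le_add (hbB z) (hLW _)))
  obtain ⟨G, hG, hPG, hGle⟩ := OffPolicy.exists_measurableSet_sum_integral_le (P := P)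
    (Z := fun e ω => (OffPolicy.discountedSum γ F (X e ω)).toReal) (M := M)
    (fun e => (OffPolicy.measurable_discountedSum hFm).ennreal_toReal.comp_aemeasurable
      (hX e).aemeasurable)
    (hInd.comp (fun _ x => (OffPolicy.discountedSum γ F x).toReal)
      fun _ => (OffPolicy.measurable_discountedSum hFm).ennreal_toReal)
    (fun e ω => ⟨ENNReal.toReal_nonneg, ENNReal.toReal_le_of_le_ofReal (by positivity)
      (OffPolicy.discountedSum_le hγ0' hγ1 hFM _)⟩) hw hδ0 hδ1
  refine ⟨G, hG, hPG, fun ω hω => ?_⟩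
  have hWpos : 0 < ∑ e, w e := Finset.sum_pos (fun e _ => hw e) Finset.univ_nonempty
  have hbias := OffPolicy.lintegral_behaviorPolicy_le ν γ ρ₀ T π w hρ₀ hT hγ0' hγ1 hw πN hfm
    hbm.ennreal_ofReal (k := k) (ENNReal.ofReal_ne_top (r := B))
    (fun z => ENNReal.ofReal_le_ofReal (hgB z))
    (OffPolicy.ofReal_abs_sub_qFunction_le hγ0' hγ1 hr hC T πN hQ hRange hRangeN)
    (OffPolicy.lintegral_le_add_policyGap ν γ ρ₀ T π w πN f)
  have hfin (e : Fin N) :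
      ∫⁻ s, ∫⁻ a, F (s, a) ∂(π e s) ∂(OffPolicy.occupancy γ ρ₀ T (π e)) ≠ ⊤ := by
    have := OffPolicy.occupancy_isProbabilityMeasure γ ρ₀ T (π e) hγ0' hγ1
    refine ne_top_of_le_ne_top (ENNReal.ofReal_ne_top (r := M)) ?_
    calc _ ≤ ∫⁻ s, ∫⁻ a, ENNReal.ofReal M ∂(π e s) ∂(OffPolicy.occupancy γ ρ₀ T (π e)) :=
          lintegral_mono fun s => lintegral_mono fun a => hFM _
      _ = ENNReal.ofReal M := by simp
  have hmean : (∑ e, w e) * ((1 - γ) *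
      ∫ s, ∫ a, |Qhat s a - q s a| ∂(OffPolicy.behaviorPolicy ν γ ρ₀ T π w s) ∂ρ₀) ≤
      ∑ e, w e * ∫ ω', (OffPolicy.discountedSum γ F (X e ω')).toReal ∂P := by
    have h := ENNReal.toReal_mono (ENNReal.sum_ne_top.2 fun e _ =>
      ENNReal.mul_ne_top ENNReal.ofReal_ne_top (hfin e)) hbias
    rw [← ENNReal.ofReal_sum_of_nonneg fun e _ => (hw e).le, ENNReal.toReal_mul,
      ENNReal.toReal_mul, ENNReal.toReal_ofReal hWpos.le, ENNReal.toReal_ofReal hγ.le,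
      ENNReal.toReal_sum fun e _ => ENNReal.mul_ne_top ENNReal.ofReal_ne_top (hfin e)] at h
    rw [OffPolicy.integral_behaviorPolicy_eq_toReal ν γ ρ₀ T π w hgm (fun z => abs_nonneg _) hgB]
    refine h.trans_eq (Finset.sum_congr rfl fun e _ => ?_)
    rw [ENNReal.toReal_mul, ENNReal.toReal_ofReal (hw e).le,
      OffPolicy.integral_discountedSum hγ0' hγ1 (hX e) hFm ENNReal.ofReal_ne_top hFM]
  have hemp : ∑ e, w e * (OffPolicy.discountedSum γ F (X e ω)).toReal ≤
      (∑ e, w e) * (OffPolicy.weightedAverage γ w (fun e => X e ω)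
          (fun s a => |Qhat s a - OffPolicy.bellman γ r T πN Qhat s a|)
        + 2 * L * OffPolicy.weightedAverage γ w (fun e => X e ω) (fun s _ => W1 s)) := by
    rw [mul_add, mul_left_comm, OffPolicy.sum_mul_weightedAverage hWpos.ne',
      OffPolicy.sum_mul_weightedAverage hWpos.ne', Finset.mul_sum, ← Finset.sum_add_distrib]
    refine Finset.sum_le_sum fun e _ => ?_
    rw [mul_left_comm, ← mul_add]
    refine mul_le_mul_of_nonneg_left ?_ (hw e).le
    refine (OffPolicy.toReal_discountedSum_le hγ0' hγ1
      (fun z => add_nonneg (abs_nonneg _) (hLW0 z.1))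
      (fun z => add_le_add (hbB z) (hLW z.1)) hFle (X e ω)).trans_eq ?_
    rw [← tsum_mul_left, ← Summable.tsum_add]
    · exact tsum_congr fun i => by ring
    · exact OffPolicy.summable_discount_mul hγ0' hγ1 (u := fun i => b (X e ω i))
        fun i => (abs_of_nonneg (abs_nonneg _)).trans_le (hbB _)
    · exact (OffPolicy.summable_discount_mul hγ0' hγ1 (u := fun i => W1 (X e ω i).1)
        fun i => (abs_of_nonneg (hW0 _)).trans_le (hWd _)).mul_left _
  have hconc := hGle ω hω
  set V := ∑ e, w e with hV
  set R := √((∑ e, w e ^ 2) / 2 * Real.log (2 / δ)) with hR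
  have hR0 : 0 ≤ R := Real.sqrt_nonneg _
  have hs1 : √((∑ e, w e ^ 2) / (2 * V ^ 2) * Real.log (2 / δ)) = R / V := by
    rw [hR, ← Real.sqrt_sq hWpos.le, ← Real.sqrt_div' _ (sq_nonneg V), Real.sqrt_sq hWpos.le]
    congr 1
    field_simp
  have hs2 : √(2 * (∑ e, w e ^ 2) / V ^ 2 * Real.log (2 / δ)) = 2 * R / V := by
    have : 2 * (∑ e, w e ^ 2) / V ^ 2 * Real.log (2 / δ) =
        (2 / V) ^ 2 * ((∑ e, w e ^ 2) / 2 * Real.log (2 / δ)) := by field_simp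
    rw [this, Real.sqrt_mul (sq_nonneg _), Real.sqrt_sq (by positivity)]
    ring
  rw [hs1, hs2]
  set I := ∫ s, ∫ a, |Qhat s a - q s a| ∂(OffPolicy.behaviorPolicy ν γ ρ₀ T π w s) ∂ρ₀
  set E := OffPolicy.weightedAverage γ w (fun e => X e ω)
          (fun s a => |Qhat s a - OffPolicy.bellman γ r T πN Qhat s a|)
        + 2 * L * OffPolicy.weightedAverage γ w (fun e => X e ω) (fun s _ => W1 s) with hE
  -- Chain of `hmean` (bias), `hconc` (Hoeffding) and `hemp` (gap against Wasserstein distance along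
  -- the sample).
  have hmain : V * ((1 - γ) * I) ≤ V * E + M * R := by linarith
  have hI : I ≤ 1 / (1 - γ) * E + M / (1 - γ) * (R / V) := by
    have : I = V * ((1 - γ) * I) / (V * (1 - γ)) := by field_simp
    rw [this]
    calc _ ≤ (V * E + M * R) / (V * (1 - γ)) := by gcongr
      _ = _ := by field_simp
  have hB2 : rmax / (1 - γ) ^ 2 = B / (1 - γ) := by rw [hB, div_div, sq]
  -- The `2 * B` in `M` is absorbed by the factor 2 in `2 * R / V`. The first square-root term of
  -- the claim and half of the diameter term are slack.
  have hfinal : M / (1 - γ) * (R / V) ≤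
      B * (R / V) + (rmax / (1 - γ) ^ 2 + 2 * L * d / (1 - γ)) * (2 * R / V) := by
    have hexp : B * (R / V) + (rmax / (1 - γ) ^ 2 + 2 * L * d / (1 - γ)) * (2 * R / V) =
        M / (1 - γ) * (R / V) + (B + 2 * L * d / (1 - γ)) * (R / V) := by
      rw [hB2, hM]; ring
    rw [hexp]
    have : 0 ≤ (B + 2 * L * d / (1 - γ)) * (R / V) := by positivity
    linarith
  linarith
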